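/- Let $f:\mathbb R\to\mathbb R$ be a nonconstant, increasing (i.e. $x\le y\Rightarrow f(x)\le f(y)$) and convex function. Let $D\subsetneq\mathbb C^n$ be a proper domain (a nonempty connected open set different from $\mathbb C^n$), and let $U\subset\mathbb C^n$ be an open neighbourhood of the boundary $\partial D$. Let $s_D$ be the signed Euclidean distance to $\partial D$, that is, $s_D(z)=\operatorname{dist}(z,\partial D)$ for $z\in D$ and $s_D(z)=-\operatorname{dist}(z,\partial D)$ for $z\notin D$, and put $q_D=-\log s_D$ on $D$. Then $D$ is pseudoconvex (i.e. there is a continuous plurisubharmonic function $\varphi:D\to\mathbb R$ such that $\{z\in D:\varphi(z)\le c\}$ is compact for every $c\in\mathbb R$) if and only if $f\circ q_D$ is plurisubharmonic on the open set $D\cap U$. -/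

import Mathlib

namespace RigidPsc

/-- A real-valued function `v` is subharmonic on the open set `G ⊆ ℂ`: it is upper semicontinuous
on `G`, and on every closed disc contained in `G` its value at the centre is at most its mean over
the boundary circle. (For a real-valued function, a mean that dominates a real number is finite;
this is the integrability clause, which keeps the mean from being a default value.) -/
def SubharmonicOn (v : ℂ → ℝ) (G : Set ℂ) : Prop :=
  UpperSemicontinuousOn v G ∧
    ∀ (c : ℂ) (r : ℝ), 0 < r → Metric.closedBall c r ⊆ G →
      CircleIntegrable v c r ∧ v c ≤ Real.circleAverage v c r

/-- A real-valued function `u` is plurisubharmonic on the open set `Ω ⊆ ℂⁿ`: it is upper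
semicontinuous on `Ω`, and its restriction to every complex line is subharmonic. -/
def PlurisubharmonicOn {n : ℕ} (u : EuclideanSpace ℂ (Fin n) → ℝ)
    (Ω : Set (EuclideanSpace ℂ (Fin n))) : Prop :=
  UpperSemicontinuousOn u Ω ∧
    ∀ a b : EuclideanSpace ℂ (Fin n),
      SubharmonicOn (fun ζ : ℂ => u (a + ζ • b)) {ζ : ℂ | a + ζ • b ∈ Ω}

/-- The open set `D ⊆ ℂⁿ` is pseudoconvex: it carries a continuous plurisubharmonic exhaustion
function, i.e. one whose sublevel sets in `D` are compact. -/
def IsPseudoconvex {n : ℕ} (D : Set (EuclideanSpace ℂ (Fin n))) : Prop :=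
  IsOpen D ∧ ∃ φ : EuclideanSpace ℂ (Fin n) → ℝ,
    ContinuousOn φ D ∧ PlurisubharmonicOn φ D ∧ ∀ c : ℝ, IsCompact {z | z ∈ D ∧ φ z ≤ c}

open Classical in
/-- The signed Euclidean distance to `∂D`, positive in `D` and nonpositive off `D`. -/
noncomputable def signedBoundaryDist {n : ℕ} (D : Set (EuclideanSpace ℂ (Fin n)))
    (z : EuclideanSpace ℂ (Fin n)) : ℝ :=
  if z ∈ D then Metric.infDist z (frontier D) else -Metric.infDist z (frontier D)

/-- The function `q_D = -log s_D`, meaningful on `D`, where `s_D > 0`. -/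
noncomputable def negLogDist {n : ℕ} (D : Set (EuclideanSpace ℂ (Fin n)))
    (z : EuclideanSpace ℂ (Fin n)) : ℝ :=
  -Real.log (signedBoundaryDist D z)

end RigidPsc

/-!
The two implications are consequences of one statement,
`plurisubharmonicOn_negLogDist_of_barrier`: if near `∂D` there is a continuous plurisubharmonic
function `u` that tends to `∞` at every boundary point, then `q_D = -log dist(·, ∂D)` is
plurisubharmonic on all of `D`. If `D` is pseudoconvex, an exhaustion function is such a `u`, and
Jensen's inequality passes from `q_D` to `f ∘ q_D`. Conversely, `f ∘ q_D` is such a `u`, because a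
nonconstant increasing convex function tends to `∞` at `∞`; and once `q_D` is plurisubharmonic on
`D`, the function `q_D + ‖z‖` is a continuous plurisubharmonic exhaustion function.

The statement on barriers is Oka's argument with families of discs. By density of trigonometric
polynomials (`le_circleAverage_of_entire_majorants`), the sub-mean value inequality of `q_D` has to
be tested only against real parts of entire functions `P`. If `q_D(z + τ w) ≤ Re P(τ)` on a circle,
but not at its centre, then the discs `τ ↦ z + τ w + t e^{-P(τ)} e`, with `|e| < 1` suitable and
`0 ≤ t ≤ 1`, have their boundary in `D`, while for `t = 1` the disc hits `∂D`. At the first `t` for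
which the disc meets `∂D`, the blow-up of `u` contradicts the maximum principle for `u` on a piece
of the disc (`disc_mem_of_barrier`).

These discs are not contained in complex lines, while plurisubharmonicity is defined by complex
lines. The maximum principle on them (`le_on_disc_of_le_on_frontier`) is obtained without smoothing
of `u`: let the parameter `t` be a complex variable `μ` and maximise
`u + ε|τ|² - M|μ - μ₀|²` over the discs with parameter near `μ₀`. For small `ε` and large `M` the
maximum is attained in the interior if the maximum principle fails. The complex line tangent to
the disc through the maximum point is, in the coordinates `(τ, μ)`, a holomorphic curve on which `μ`
is stationary, so the penalty `M|μ - μ₀|²` is harmonic up to fourth order along it, and the term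
`ε|τ|²` violates the sub-mean value inequality of `u` (`not_eventually_penalized_le`).
-/

open Complex Filter Metric Set Topology

namespace RigidPsc

/-! ### Circle averages and entire functions -/

theorem circleAverage_re_of_differentiable {F : ℂ → ℂ} (hF : Differentiable ℂ F) (c : ℂ) (r : ℝ) :
    Real.circleAverage (fun ζ => (F ζ).re) c r = (F c).re := by
  have h := Complex.reCLM.circleAverage_comp_comm (f := F) (c := c) (R := r)
    hF.continuous.continuousOn.circleIntegrable'
  have h2 : Real.circleAverage F c r = F c :=
    DiffContOnCl.circleAverage (hF.diffContOnCl)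
  rw [h2] at h
  exact h

theorem circleIntegrable_re_of_differentiable {F : ℂ → ℂ} (hF : Differentiable ℂ F) (c : ℂ)
    {r : ℝ} (hr : 0 ≤ r) : CircleIntegrable (fun ζ => (F ζ).re) c r :=
  (Complex.continuous_re.comp hF.continuous).continuousOn.circleIntegrable hr

/-- A trigonometric polynomial on the circle of radius `r` is the sum of an entire function and a
conjugate of one; this form, unlike a real part, is stable under complex scalars. -/
theorem exists_entire_add_conj_entire_eq_on_sphere {r : ℝ} (hr : 0 < r)
    (p : C(AddCircle (1 : ℝ), ℂ)) (hp : p ∈ Submodule.span ℂ (range (@fourier (1 : ℝ)))) :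
    ∃ Q R : ℂ → ℂ, Differentiable ℂ Q ∧ Differentiable ℂ R ∧
      ∀ x, p x = Q (r * x.toCircle) + (starRingEnd ℂ) (R (r * x.toCircle)) := by
  have hr' : (r : ℂ) ≠ 0 := by exact_mod_cast hr.ne'
  induction hp using Submodule.span_induction with
  | mem p hp =>
    obtain ⟨n, rfl⟩ := hp
    obtain ⟨m, rfl | rfl⟩ := n.eq_nat_or_neg
    · refine ⟨fun ζ => (ζ / r) ^ m, 0, by fun_prop, differentiable_const 0, fun x => ?_⟩
      simp [fourier_apply, AddCircle.toCircle_nsmul, hr']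
    · refine ⟨0, fun ζ => (ζ / r) ^ m, differentiable_const 0, by fun_prop, fun x => ?_⟩
      rw [fourier_neg]
      simp [AddCircle.toCircle_nsmul, hr']
  | zero => exact ⟨0, 0, differentiable_const 0, differentiable_const 0, fun x => by simp⟩
  | add p q _ _ hp hq =>
    obtain ⟨Q, R, hQ, hR, h⟩ := hp
    obtain ⟨Q', R', hQ', hR', h'⟩ := hq
    refine ⟨Q + Q', R + R', hQ.add hQ', hR.add hR', fun x => ?_⟩
    simp only [ContinuousMap.add_apply, h, h', Pi.add_apply, map_add]
    ring
  | smul a p _ hp =>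
    obtain ⟨Q, R, hQ, hR, h⟩ := hp
    refine ⟨fun ζ => a * Q ζ, fun ζ => (starRingEnd ℂ) a * R ζ, by fun_prop, by fun_prop,
      fun x => ?_⟩
    simp only [ContinuousMap.smul_apply, h, smul_eq_mul, map_mul, Complex.conj_conj]
    ring

/-- Weierstrass approximation on the circle, by real parts of entire functions. -/
theorem exists_entire_re_near {r : ℝ} (hr : 0 < r) {v : ℂ → ℝ} (hv : ContinuousOn v (sphere 0 r))
    {ε : ℝ} (hε : 0 < ε) :
    ∃ P : ℂ → ℂ, Differentiable ℂ P ∧ ∀ ζ ∈ sphere (0 : ℂ) r, |v ζ - (P ζ).re| < ε := by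
  have hmem : ∀ x : AddCircle (1 : ℝ), (r * x.toCircle : ℂ) ∈ sphere (0 : ℂ) r := fun x => by
    simp [abs_of_pos hr, Circle.norm_coe]
  have hcont : Continuous fun x : AddCircle (1 : ℝ) => ((v (r * x.toCircle) : ℝ) : ℂ) := by
    refine Complex.continuous_ofReal.comp (hv.comp_continuous ?_ hmem)
    exact continuous_const.mul (continuous_subtype_val.comp AddCircle.continuous_toCircle)
  let h : C(AddCircle (1 : ℝ), ℂ) := ⟨_, hcont⟩
  have hd : h ∈ (Submodule.span ℂ (range (@fourier (1 : ℝ)))).topologicalClosure := by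
    rw [span_fourier_closure_eq_top]; trivial
  obtain ⟨p, hp, hdist⟩ := Metric.mem_closure_iff.1 hd ε hε
  obtain ⟨Q, R, hQ, hR, hQR⟩ := exists_entire_add_conj_entire_eq_on_sphere hr p hp
  refine ⟨fun ζ => Q ζ + R ζ, hQ.add hR, fun ζ hζ => ?_⟩
  have hζn : ‖ζ‖ = r := by simpa using hζ
  obtain ⟨x, hx⟩ : ∃ x : AddCircle (1 : ℝ), (r * x.toCircle : ℂ) = ζ := by
    let z : Circle := ⟨ζ / r, by
      change ζ / r ∈ sphere (0 : ℂ) 1; simp [hζn, abs_of_pos hr, hr.ne']⟩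
    refine ⟨(AddCircle.homeomorphCircle one_ne_zero).symm z, ?_⟩
    rw [← AddCircle.homeomorphCircle_apply one_ne_zero, Homeomorph.apply_symm_apply]
    have hr' : (r : ℂ) ≠ 0 := by exact_mod_cast hr.ne'
    change (r : ℂ) * (ζ / r) = ζ
    field_simp
  have h1 : dist (h x) (p x) < ε := (ContinuousMap.dist_apply_le_dist x).trans_lt hdist
  have h2 : v ζ - (Q ζ + R ζ).re = (h x - p x).re := by
    rw [hQR, hx]
    simp [h, hx]
  rw [h2]
  exact (Complex.abs_re_le_norm _).trans_lt (by rwa [dist_eq_norm] at h1)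

/-- The sub-mean value inequality has to be tested only against real parts of entire functions,
which satisfy the mean value property and approximate `v` on the circle. -/
theorem le_circleAverage_of_entire_majorants {c : ℂ} {r : ℝ} (hr : 0 < r) {v : ℂ → ℝ}
    (hv : ContinuousOn v (sphere c r))
    (h : ∀ P : ℂ → ℂ, Differentiable ℂ P → (∀ ζ ∈ sphere c r, v ζ ≤ (P ζ).re) → v c ≤ (P c).re) :
    v c ≤ Real.circleAverage v c r := by
  refine le_of_forall_pos_le_add fun ε hε => ?_
  have hv0 : ContinuousOn (fun ζ => v (ζ + c)) (sphere 0 r) := by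
    refine hv.comp (by fun_prop) fun ζ hζ => ?_
    simpa using hζ
  obtain ⟨P, hP, hPv⟩ := exists_entire_re_near hr hv0 (half_pos hε)
  have hPv' : ∀ ζ ∈ sphere c r, |v ζ - (P (ζ - c)).re| < ε / 2 := fun ζ hζ => by
    have := hPv (ζ - c) (by simpa [dist_eq_norm] using hζ)
    simpa using this
  have hint : CircleIntegrable v c r := hv.circleIntegrable hr.le
  have h1 := h (fun ζ => P (ζ - c) + (ε / 2 : ℝ)) (by fun_prop) fun ζ hζ => by
    have := (abs_lt.1 (hPv' ζ hζ)).2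
    simp only [add_re, ofReal_re]; linarith
  have h2 : Real.circleAverage (fun ζ => (P (ζ - c) + (-(ε / 2) : ℝ)).re) c r
      ≤ Real.circleAverage v c r := by
    refine Real.circleAverage_mono ?_ hint fun ζ hζ => ?_
    · exact circleIntegrable_re_of_differentiable (by fun_prop) c hr.le
    · rw [abs_of_pos hr] at hζ
      have := (abs_lt.1 (hPv' ζ hζ)).1
      simp only [add_re, ofReal_re]; linarith
  rw [circleAverage_re_of_differentiable (by fun_prop)] at h2
  simp only [add_re, ofReal_re] at h1 h2
  linarith

/-- A function that lies below the strictly superharmonic function `v(0) + Re H - δ|ζ|²`, with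
equality at `0`, violates the sub-mean value inequality on small circles. -/
theorem not_subharmonicOn_of_eventually_le {v : ℂ → ℝ} {G : Set ℂ} (hv : SubharmonicOn v G)
    (hG : G ∈ 𝓝 0) {H : ℂ → ℂ} (hH : Differentiable ℂ H) (hH0 : H 0 = 0) {δ : ℝ} (hδ : 0 < δ)
    (hle : ∀ᶠ ζ in 𝓝 0, v ζ ≤ v 0 + (H ζ).re - δ * ‖ζ‖ ^ 2) : False := by
  obtain ⟨ρ, hρ, hball⟩ := Metric.nhds_basis_closedBall.eventually_iff.1 (hle.and hG)
  obtain ⟨hint, hmean⟩ := hv.2 0 ρ hρ fun ζ hζ => (hball hζ).2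
  have h2 : Real.circleAverage v 0 ρ
      ≤ Real.circleAverage (fun ζ => (H ζ + (v 0 - δ * ρ ^ 2 : ℝ)).re) 0 ρ := by
    refine Real.circleAverage_mono hint ?_ fun ζ hζ => ?_
    · exact circleIntegrable_re_of_differentiable (by fun_prop) 0 hρ.le
    · rw [abs_of_pos hρ] at hζ
      have := (hball (sphere_subset_closedBall hζ)).1
      have hn : ‖ζ‖ = ρ := by simpa using hζ
      rw [hn] at this
      simp only [add_re, ofReal_re]; linarith
  rw [circleAverage_re_of_differentiable (by fun_prop)] at h2
  simp only [add_re, ofReal_re, hH0, zero_re] at h2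
  have : 0 < δ * ρ ^ 2 := by positivity
  linarith

/-! ### Basic properties of plurisubharmonic functions -/

variable {n : ℕ}

theorem PlurisubharmonicOn.mono {u : EuclideanSpace ℂ (Fin n) → ℝ}
    {Ω Ω' : Set (EuclideanSpace ℂ (Fin n))} (hu : PlurisubharmonicOn u Ω) (h : Ω' ⊆ Ω) :
    PlurisubharmonicOn u Ω' :=
  ⟨hu.1.mono h, fun a b => ⟨(hu.2 a b).1.mono fun _ hζ => h hζ,
    fun c r hr hball => (hu.2 a b).2 c r hr (hball.trans fun _ hζ => h hζ)⟩⟩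

/-- For continuous functions, plurisubharmonicity is the sub-mean value inequality on discs in
complex lines: the semicontinuity and integrability clauses are automatic. -/
theorem plurisubharmonicOn_of_continuousOn {u : EuclideanSpace ℂ (Fin n) → ℝ}
    {Ω : Set (EuclideanSpace ℂ (Fin n))} (hu : ContinuousOn u Ω)
    (h : ∀ (a b : EuclideanSpace ℂ (Fin n)) (c : ℂ) (r : ℝ), 0 < r →
      (∀ ζ ∈ closedBall c r, a + ζ • b ∈ Ω) →
      ContinuousOn (fun ζ : ℂ => u (a + ζ • b)) (sphere c r) →
      u (a + c • b) ≤ Real.circleAverage (fun ζ : ℂ => u (a + ζ • b)) c r) :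
    PlurisubharmonicOn u Ω := by
  refine ⟨hu.upperSemicontinuousOn, fun a b => ?_⟩
  have hline : ContinuousOn (fun ζ : ℂ => u (a + ζ • b)) {ζ | a + ζ • b ∈ Ω} :=
    hu.comp (by fun_prop) fun ζ hζ => hζ
  refine ⟨hline.upperSemicontinuousOn, fun c r hr hball => ?_⟩
  have hsph := hline.mono (sphere_subset_closedBall.trans hball)
  exact ⟨hsph.circleIntegrable hr.le, h a b c r hr hball hsph⟩

/-- Jensen's inequality for circle averages. -/
theorem _root_.ConvexOn.map_circleAverage_le {E : Type*} [NormedAddCommGroup E] [NormedSpace ℝ E]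
    [CompleteSpace E] {f : E → ℝ}
    (hf : ConvexOn ℝ univ f) (hfc : Continuous f) {v : ℂ → E} {c : ℂ} {r : ℝ}
    (hv : CircleIntegrable v c r) (hfv : CircleIntegrable (fun ζ => f (v ζ)) c r) :
    f (Real.circleAverage v c r) ≤ Real.circleAverage (fun ζ => f (v ζ)) c r := by
  have h2π : (0 : ℝ) < 2 * Real.pi := Real.two_pi_pos
  rw [Real.circleAverage_eq_intervalAverage, Real.circleAverage_eq_intervalAverage]
  have : NeZero (MeasureTheory.volume.restrict (uIoc 0 (2 * Real.pi))) := by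
    refine ⟨?_⟩
    rw [Ne, MeasureTheory.Measure.restrict_eq_zero, uIoc_of_le h2π.le, Real.volume_Ioc]
    simpa using Real.pi_pos
  have : MeasureTheory.IsFiniteMeasure
      (MeasureTheory.volume.restrict (uIoc 0 (2 * Real.pi))) := by
    rw [uIoc_of_le h2π.le]
    infer_instance
  refine hf.map_average_le hfc.continuousOn isClosed_univ (by simp) ?_ ?_
  · exact (intervalIntegrable_iff.1 hv)
  · exact (intervalIntegrable_iff.1 hfv)

theorem PlurisubharmonicOn.convex_comp {u : EuclideanSpace ℂ (Fin n) → ℝ}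
    {Ω : Set (EuclideanSpace ℂ (Fin n))} (hu : PlurisubharmonicOn u Ω) (huc : ContinuousOn u Ω)
    {f : ℝ → ℝ} (hf : Monotone f) (hfc : ConvexOn ℝ univ f) :
    PlurisubharmonicOn (fun z => f (u z)) Ω := by
  have hcont : Continuous f := continuousOn_univ.1 (hfc.continuousOn isOpen_univ)
  refine plurisubharmonicOn_of_continuousOn (hcont.comp_continuousOn huc) ?_
  intro a b c r hr hball hint
  obtain ⟨h1, h2⟩ := (hu.2 a b).2 c r hr hball
  exact (hf h2).trans (hfc.map_circleAverage_le hcont h1 (hint.circleIntegrable hr.le))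

theorem plurisubharmonicOn_norm (Ω : Set (EuclideanSpace ℂ (Fin n))) :
    PlurisubharmonicOn (fun z => ‖z‖) Ω := by
  refine plurisubharmonicOn_of_continuousOn continuous_norm.continuousOn ?_
  intro a b c r hr _ hint
  have hd : Differentiable ℂ fun ζ : ℂ => a + ζ • b := by fun_prop
  have h1 : Real.circleAverage (fun ζ : ℂ => a + ζ • b) c r = a + c • b :=
    DiffContOnCl.circleAverage hd.diffContOnCl
  have h2 := (convexOn_norm (E := EuclideanSpace ℂ (Fin n)) convex_univ).map_circleAverage_le
    continuous_norm (hd.continuous.continuousOn.circleIntegrable hr.le)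
    (hint.circleIntegrable hr.le)
  rwa [h1] at h2

theorem PlurisubharmonicOn.add {u v : EuclideanSpace ℂ (Fin n) → ℝ}
    {Ω : Set (EuclideanSpace ℂ (Fin n))} (hu : PlurisubharmonicOn u Ω)
    (hv : PlurisubharmonicOn v Ω) : PlurisubharmonicOn (fun z => u z + v z) Ω := by
  refine ⟨hu.1.add hv.1, fun a b => ⟨(hu.2 a b).1.add (hv.2 a b).1, fun c r hr hball => ?_⟩⟩
  obtain ⟨h1, h2⟩ := (hu.2 a b).2 c r hr hball
  obtain ⟨h3, h4⟩ := (hv.2 a b).2 c r hr hball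
  refine ⟨h1.add h3, ?_⟩
  rw [Real.circleAverage_fun_add h1 h3]
  exact add_le_add h2 h4

theorem _root_.Monotone.tendsto_atTop_of_convexOn {f : ℝ → ℝ} (hf : Monotone f)
    (hfc : ConvexOn ℝ univ f) (hne : ∃ x y : ℝ, f x ≠ f y) : Tendsto f atTop atTop := by
  obtain ⟨x, y, hxy, hlt⟩ : ∃ x y, x < y ∧ f x < f y := by
    obtain ⟨x, y, h⟩ := hne
    rcases lt_trichotomy x y with h' | rfl | h'
    · exact ⟨x, y, h', lt_of_le_of_ne (hf h'.le) h⟩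
    · exact absurd rfl h
    · exact ⟨y, x, h', lt_of_le_of_ne (hf h'.le) h.symm⟩
  set k := (f y - f x) / (y - x) with hk
  have hk0 : 0 < k := div_pos (sub_pos.2 hlt) (sub_pos.2 hxy)
  -- Beyond `y`, the graph lies above the chord through `x` and `y`.
  have hbound : ∀ t > y, f y + k * (t - y) ≤ f t := fun t ht => by
    have h := hfc.slope_mono_adjacent (mem_univ x) (mem_univ t) hxy ht
    rw [le_div_iff₀ (sub_pos.2 ht)] at h
    linarith
  refine tendsto_atTop_mono' atTop ?_ (f₁ := fun t => f y + k * (t - y)) ?_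
  · filter_upwards [eventually_gt_atTop y] with t ht using hbound t ht
  · exact tendsto_atTop_add_const_left _ _
      ((tendsto_atTop_add_const_right _ _ tendsto_id).const_mul_atTop hk0)

/-! ### The maximum principle on holomorphic discs -/

/-- The family of holomorphic discs `τ ↦ z + τ w + μ g(τ) e`, with parameter `μ ∈ ℂ`: the complex
line `τ ↦ z + τ w`, pushed in the direction `e` by the amount `μ g(τ)`. The argument is `(τ, μ)`. -/
def discFamily (z w e : EuclideanSpace ℂ (Fin n)) (g : ℂ → ℂ) (x : ℂ × ℂ) :
    EuclideanSpace ℂ (Fin n) :=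
  z + x.1 • w + (x.2 * g x.1) • e

theorem continuous_discFamily (z w e : EuclideanSpace ℂ (Fin n)) {g : ℂ → ℂ} (hg : Continuous g) :
    Continuous (discFamily z w e g) := by
  unfold discFamily
  fun_prop

/-- The function `u + ε|τ|² - M|μ - μ₀|²` has no local maximum. The line tangent to the disc at the
point with coordinates `(τ₁, μ₁)` is the image of a holomorphic curve `ζ ↦ (τ₁ + ζ, Λ(ζ))` with
`Λ'(0) = 0`; along it `ε|τ|² - M|μ - μ₀|²` is, up to the real part of a holomorphic function, at
least `ε|ζ|² / 2`, so that a maximum would contradict the sub-mean value inequality of `u`. -/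
theorem not_eventually_penalized_le {Ω : Set (EuclideanSpace ℂ (Fin n))}
    (hΩ : IsOpen Ω) {u : EuclideanSpace ℂ (Fin n) → ℝ} (hu : PlurisubharmonicOn u Ω)
    {z w e : EuclideanSpace ℂ (Fin n)} {g : ℂ → ℂ} (hg : Differentiable ℂ g) (hg0 : ∀ τ, g τ ≠ 0)
    {τ₁ μ₁ μ₀ : ℂ} (hmem : discFamily z w e g (τ₁, μ₁) ∈ Ω) {ε M : ℝ} (hε : 0 < ε)
    (hmax : ∀ᶠ x in 𝓝 (τ₁, μ₁),
      u (discFamily z w e g x) + ε * ‖x.1‖ ^ 2 - M * ‖x.2 - μ₀‖ ^ 2 ≤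
        u (discFamily z w e g (τ₁, μ₁)) + ε * ‖τ₁‖ ^ 2 - M * ‖μ₁ - μ₀‖ ^ 2) : False := by
  set p := discFamily z w e g (τ₁, μ₁) with hp
  set b := w + (μ₁ * deriv g τ₁) • e with hb
  set Λ : ℂ → ℂ := fun ζ => μ₁ * (g τ₁ + ζ * deriv g τ₁) / g (τ₁ + ζ) with hΛ
  have hΛd : Differentiable ℂ Λ := by
    intro ζ
    have := hg0 (τ₁ + ζ)
    fun_prop (disch := assumption)
  have hΛ0 : Λ 0 = μ₁ := by
    have := hg0 τ₁
    simp [hΛ, this]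
  have hΛ' : HasDerivAt Λ 0 0 := by
    have h1 : HasDerivAt (fun ζ : ℂ => μ₁ * (g τ₁ + ζ * deriv g τ₁)) (μ₁ * (1 * deriv g τ₁)) 0 :=
      (((hasDerivAt_id (0 : ℂ)).mul_const _).const_add _).const_mul _
    have h2 : HasDerivAt (fun ζ : ℂ => g (τ₁ + ζ)) (deriv g τ₁) 0 := by
      have := (hg (τ₁ + 0)).hasDerivAt
      simpa using this.comp_const_add τ₁ 0
    have h3 := h1.div h2 (hg0 _)
    refine h3.congr_deriv ?_
    simp only [add_zero, zero_mul, one_mul]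
    ring
  have hcurve : ∀ ζ, discFamily z w e g (τ₁ + ζ, Λ ζ) = p + ζ • b := by
    intro ζ
    have h0 := hg0 (τ₁ + ζ)
    simp only [discFamily, hp, hb, hΛ, div_mul_cancel₀ _ h0]
    module
  have hlim : Tendsto (fun ζ => (τ₁ + ζ, Λ ζ)) (𝓝 0) (𝓝 (τ₁, μ₁)) := by
    have : Continuous fun ζ => (τ₁ + ζ, Λ ζ) := by
      have := hΛd.continuous
      fun_prop
    simpa [hΛ0] using this.tendsto 0
  -- `Λ - μ₁ = o(ζ)`, so the penalty on the parameter is absorbed by half of the gain `ε|ζ|²`.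
  have hsmall : ∀ᶠ ζ in 𝓝 (0 : ℂ), M * ‖Λ ζ - μ₁‖ ^ 2 ≤ ε / 2 * ‖ζ‖ ^ 2 := by
    have ho := (hasDerivAt_iff_isLittleO.1 hΛ').def
      (c := Real.sqrt (ε / (2 * (|M| + 1)))) (by positivity)
    filter_upwards [ho] with ζ hζ
    simp only [hΛ0, sub_zero, smul_zero] at hζ
    have h1 : ‖Λ ζ - μ₁‖ ^ 2 ≤ ε / (2 * (|M| + 1)) * ‖ζ‖ ^ 2 := by
      calc _ ≤ (Real.sqrt (ε / (2 * (|M| + 1))) * ‖ζ‖) ^ 2 := by gcongr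
        _ = _ := by rw [mul_pow, Real.sq_sqrt (by positivity)]
    calc M * ‖Λ ζ - μ₁‖ ^ 2 ≤ (|M| + 1) * (ε / (2 * (|M| + 1)) * ‖ζ‖ ^ 2) := by
          gcongr
          linarith [le_abs_self M]
      _ = _ := by field_simp
  have hsub := hu.2 p b
  refine not_subharmonicOn_of_eventually_le hsub ?_
    (H := fun ζ => -2 * ε * (starRingEnd ℂ) τ₁ * ζ
      + 2 * M * (starRingEnd ℂ) (μ₁ - μ₀) * (Λ ζ - μ₁)) (by fun_prop) (by simp [hΛ0])
    (half_pos hε) ?_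
  · refine (hΩ.preimage (by fun_prop : Continuous fun ζ : ℂ => p + ζ • b)).mem_nhds ?_
    simpa using hmem
  · filter_upwards [hlim.eventually hmax, hsmall] with ζ h1 h2
    rw [hcurve] at h1
    have e1 : ‖τ₁ + ζ‖ ^ 2 = ‖τ₁‖ ^ 2 + ‖ζ‖ ^ 2 + 2 * ((starRingEnd ℂ) τ₁ * ζ).re := by
      simp only [← Complex.normSq_eq_norm_sq, Complex.normSq_apply]
      simp; ring
    have e2 : ‖Λ ζ - μ₀‖ ^ 2 = ‖μ₁ - μ₀‖ ^ 2 + ‖Λ ζ - μ₁‖ ^ 2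
        + 2 * ((starRingEnd ℂ) (μ₁ - μ₀) * (Λ ζ - μ₁)).re := by
      simp only [← Complex.normSq_eq_norm_sq, Complex.normSq_apply]
      simp; ring
    have e3 : (-2 * ε * (starRingEnd ℂ) τ₁ * ζ
      + 2 * M * (starRingEnd ℂ) (μ₁ - μ₀) * (Λ ζ - μ₁)).re =
        -2 * ε * ((starRingEnd ℂ) τ₁ * ζ).re
          + 2 * M * ((starRingEnd ℂ) (μ₁ - μ₀) * (Λ ζ - μ₁)).re := by
      simp; ring
    simp only [e1, e2] at h1
    simp only [zero_smul, add_zero, e3]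
    linarith

/-- Maximum principle for a continuous plurisubharmonic function on a (possibly nonlinear)
holomorphic disc that belongs to a family `discFamily`. -/
theorem le_on_disc_of_le_on_frontier {Ω : Set (EuclideanSpace ℂ (Fin n))}
    (hΩ : IsOpen Ω) {u : EuclideanSpace ℂ (Fin n) → ℝ} (hu : PlurisubharmonicOn u Ω)
    (huc : ContinuousOn u Ω)
    {z w e : EuclideanSpace ℂ (Fin n)} {g : ℂ → ℂ} (hg : Differentiable ℂ g) (hg0 : ∀ τ, g τ ≠ 0)
    {K : Set ℂ} (hK : IsCompact K) {μ₀ : ℂ} (hKΩ : ∀ τ ∈ K, discFamily z w e g (τ, μ₀) ∈ Ω)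
    {C : ℝ} (hC : ∀ τ ∈ frontier K, u (discFamily z w e g (τ, μ₀)) ≤ C) {τ₀ : ℂ} (hτ₀ : τ₀ ∈ K) :
    u (discFamily z w e g (τ₀, μ₀)) ≤ C := by
  by_contra! hlt
  set Φ := discFamily z w e g with hΦ
  have hΦc : Continuous Φ := continuous_discFamily z w e hg.continuous
  set η := u (Φ (τ₀, μ₀)) - C with hη
  have hη0 : 0 < η := sub_pos.2 hlt
  obtain ⟨R, hR⟩ : ∃ R, ∀ τ ∈ K, ‖τ‖ ≤ R := hK.isBounded.exists_norm_le
  have hFK : frontier K ⊆ K := hK.isClosed.frontier_subset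
  have hW : IsOpen (Φ ⁻¹' Ω) := hΩ.preimage hΦc
  have hψ : ContinuousOn (u ∘ Φ) (Φ ⁻¹' Ω) := huc.comp hΦc.continuousOn (mapsTo_preimage _ _)
  have hW' : IsOpen (Φ ⁻¹' Ω ∩ (u ∘ Φ) ⁻¹' Iio (C + η / 2)) :=
    hψ.isOpen_inter_preimage hW isOpen_Iio
  -- Both the disc and the bound on its boundary persist for parameters near `μ₀`.
  obtain ⟨U₁, V₁, hU₁, hV₁, hKU₁, hμV₁, hsub₁⟩ := generalized_tube_lemma hK
    (isCompact_singleton (x := μ₀)) hW (by rintro ⟨τ, μ⟩ ⟨h1, rfl⟩; exact hKΩ τ h1)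
  obtain ⟨U₂, V₂, hU₂, hV₂, hKU₂, hμV₂, hsub₂⟩ := generalized_tube_lemma
    (hK.of_isClosed_subset isClosed_frontier hFK)
    (isCompact_singleton (x := μ₀)) hW' (by
      rintro ⟨τ, μ⟩ ⟨h1, rfl⟩
      refine ⟨hKΩ τ (hFK h1), ?_⟩
      have := hC τ h1
      simp only [mem_preimage, Function.comp, mem_Iio]
      linarith)
  obtain ⟨s, hs, hball⟩ := Metric.nhds_basis_closedBall.mem_iff.1
    ((hV₁.inter hV₂).mem_nhds ⟨singleton_subset_iff.1 hμV₁, singleton_subset_iff.1 hμV₂⟩)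
  have hQ : IsCompact (K ×ˢ closedBall μ₀ s) := hK.prod (isCompact_closedBall _ _)
  have hQW : K ×ˢ closedBall μ₀ s ⊆ Φ ⁻¹' Ω := fun x hx =>
    hsub₁ ⟨hKU₁ hx.1, (hball hx.2).1⟩
  have hx₀ : (τ₀, μ₀) ∈ K ×ˢ closedBall μ₀ s := ⟨hτ₀, mem_closedBall_self hs.le⟩
  obtain ⟨B, hB⟩ := (hQ.image_of_continuousOn (hψ.mono hQW)).bddAbove
  have hB' : ∀ x ∈ K ×ˢ closedBall μ₀ s, u (Φ x) ≤ B := fun x hx => hB ⟨x, hx, rfl⟩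
  -- `ε` is so small that the gain is at most `η / 2` on `K`, and `M` so large that the penalty
  -- beats every value of `u` at parameters with `|μ - μ₀| = s`.
  set ε := η / (2 * (R ^ 2 + 1)) with hε
  have hε0 : 0 < ε := by positivity
  have hεR : ∀ τ ∈ K, ε * ‖τ‖ ^ 2 ≤ η / 2 := fun τ hτ => by
    have h1 : ‖τ‖ ^ 2 ≤ R ^ 2 + 1 := by
      have := pow_le_pow_left₀ (norm_nonneg τ) (hR τ hτ) 2
      linarith
    calc ε * ‖τ‖ ^ 2 ≤ ε * (R ^ 2 + 1) := by gcongr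
      _ = η / 2 := by rw [hε]; field_simp
  set M := (B + η / 2 - C) / s ^ 2 with hM
  have hMs : M * s ^ 2 = B + η / 2 - C := by rw [hM]; field_simp
  obtain ⟨⟨τ₁, μ₁⟩, hx₁, hmax⟩ := hQ.exists_isMaxOn ⟨_, hx₀⟩
    (f := fun x : ℂ × ℂ => u (Φ x) + ε * ‖x.1‖ ^ 2 - M * ‖x.2 - μ₀‖ ^ 2) (by
      have h1 := hψ.mono hQW
      have h2 : ContinuousOn (fun x : ℂ × ℂ => ε * ‖x.1‖ ^ 2 - M * ‖x.2 - μ₀‖ ^ 2)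
        (K ×ˢ closedBall μ₀ s) := by fun_prop
      simp only [add_sub_assoc]
      exact h1.add h2)
  have hge := hmax hx₀
  simp only [mem_ofPred_eq, sub_self, norm_zero] at hge
  have hval : C + η ≤ u (Φ (τ₁, μ₁)) + ε * ‖τ₁‖ ^ 2 - M * ‖μ₁ - μ₀‖ ^ 2 := by
    have : 0 ≤ ε * ‖τ₀‖ ^ 2 := by positivity
    have : C + η = u (Φ (τ₀, μ₀)) := by rw [hη]; ring
    linarith
  have hM0 : 0 ≤ M := by
    have := hB' _ hx₀
    refine div_nonneg ?_ (by positivity)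
    linarith
  have hτ₁ : τ₁ ∈ interior K := by
    by_contra hni
    have hfr : τ₁ ∈ frontier K := by
      rw [hK.isClosed.frontier_eq]; exact ⟨hx₁.1, hni⟩
    have h1 : u (Φ (τ₁, μ₁)) < C + η / 2 := (hsub₂ ⟨hKU₂ hfr, (hball hx₁.2).2⟩).2
    have h2 := hεR τ₁ hx₁.1
    have h3 : 0 ≤ M * ‖μ₁ - μ₀‖ ^ 2 := by positivity
    linarith
  have hμ₁ : μ₁ ∈ ball μ₀ s := by
    by_contra hni
    have h0 : ‖μ₁ - μ₀‖ = s := by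
      refine le_antisymm (by simpa [dist_eq_norm] using hx₁.2) ?_
      simpa [dist_eq_norm] using hni
    rw [h0, hMs] at hval
    have h1 := hB' _ hx₁
    have h2 := hεR τ₁ hx₁.1
    linarith
  refine not_eventually_penalized_le hΩ hu hg hg0 (hQW hx₁) hε0 (M := M) (μ₀ := μ₀) ?_
  filter_upwards [(isOpen_interior.prod isOpen_ball).mem_nhds (mk_mem_prod hτ₁ hμ₁)] with x hx
  exact hmax ⟨interior_subset hx.1, ball_subset_closedBall hx.2⟩

/-! ### The distance to the boundary -/

theorem _root_.IsPreconnected.subset_of_disjoint_frontier {X : Type*} [TopologicalSpace X]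
    {s t : Set X} (hs : IsPreconnected s) (ht : IsOpen t) (hdisj : Disjoint s (frontier t))
    (hne : (s ∩ t).Nonempty) : s ⊆ t := by
  refine hs.subset_left_of_subset_union ht isClosed_closure.isOpen_compl
    (disjoint_compl_right.mono_right (compl_subset_compl.2 subset_closure)) (fun x hx => ?_) hne
  by_cases hxt : x ∈ t
  · exact Or.inl hxt
  · refine Or.inr fun hcl => disjoint_left.1 hdisj hx ?_
    rw [ht.frontier_eq]
    exact ⟨hcl, hxt⟩

theorem mem_of_dist_lt_infDist_frontier {D : Set (EuclideanSpace ℂ (Fin n))} (hD : IsOpen D)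
    {z y : EuclideanSpace ℂ (Fin n)} (hz : z ∈ D) (h : dist y z < infDist z (frontier D)) :
    y ∈ D := by
  have hpos : 0 < infDist z (frontier D) := dist_nonneg.trans_lt h
  have hconv : Convex ℝ (ball z (infDist z (frontier D))) := convex_ball _ _
  exact hconv.isPreconnected.subset_of_disjoint_frontier hD disjoint_ball_infDist
    ⟨z, mem_ball_self hpos, hz⟩ h

theorem infDist_frontier_pos {D : Set (EuclideanSpace ℂ (Fin n))} (hD : IsOpen D)
    (hne : (frontier D).Nonempty) {z : EuclideanSpace ℂ (Fin n)} (hz : z ∈ D) :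
    0 < infDist z (frontier D) := by
  refine (isClosed_frontier.notMem_iff_infDist_pos hne).1 fun hfr => ?_
  rw [hD.frontier_eq] at hfr
  exact hfr.2 hz

theorem negLogDist_eq {D : Set (EuclideanSpace ℂ (Fin n))} {z : EuclideanSpace ℂ (Fin n)}
    (hz : z ∈ D) : negLogDist D z = -Real.log (infDist z (frontier D)) := by
  simp [negLogDist, signedBoundaryDist, hz]

theorem continuousOn_negLogDist {D : Set (EuclideanSpace ℂ (Fin n))} (hD : IsOpen D)
    (hne : (frontier D).Nonempty) : ContinuousOn (negLogDist D) D := by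
  refine ContinuousOn.congr (f := fun z => -Real.log (infDist z (frontier D))) ?_
    fun z hz => negLogDist_eq hz
  exact ((continuous_infDist_pt _).continuousOn.log
    fun z hz => (infDist_frontier_pos hD hne hz).ne').neg

theorem tendsto_negLogDist_atTop {D : Set (EuclideanSpace ℂ (Fin n))} (hD : IsOpen D)
    {b : EuclideanSpace ℂ (Fin n)} (hb : b ∈ frontier D) :
    Tendsto (negLogDist D) (𝓝[D] b) atTop := by
  have h1 : Tendsto (fun z => infDist z (frontier D)) (𝓝[D] b) (𝓝[>] 0) := by
    refine tendsto_nhdsWithin_iff.2 ⟨?_, ?_⟩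
    · have := (continuous_infDist_pt (frontier D)).tendsto b
      rw [infDist_zero_of_mem hb] at this
      exact this.mono_left nhdsWithin_le_nhds
    · filter_upwards [self_mem_nhdsWithin] with z hz
      exact infDist_frontier_pos hD ⟨b, hb⟩ hz
  have h2 := tendsto_neg_atBot_atTop.comp (Real.tendsto_log_nhdsGT_zero.comp h1)
  refine h2.congr' ?_
  filter_upwards [self_mem_nhdsWithin] with z hz
  exact (negLogDist_eq hz).symm

/-! ### Families of discs and barriers -/

/-- A continuous family of discs `Φ(t, ·)`, `0 ≤ t ≤ 1`, that starts in `D` and whose boundary stays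
in `D` cannot leave `D`, if near `∂D` there is a continuous function `u` that blows up at `∂D` and
satisfies the maximum principle on all pieces of the discs: at the first parameter at which the
disc meets `∂D`, the blow-up contradicts the maximum principle on a part of the disc near the
points of contact. -/
theorem disc_mem_of_barrier {E : Type*} [TopologicalSpace E] {D U : Set E}
    (hD : IsOpen D) (hU : IsOpen U) (hDU : frontier D ⊆ U) {u : E → ℝ}
    (huc : ContinuousOn u (D ∩ U)) (hub : ∀ b ∈ frontier D, Tendsto u (𝓝[D] b) atTop)
    {Φ : ℝ × ℂ → E} (hΦ : Continuous Φ)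
    (hmax : ∀ (t : ℝ) (K : Set ℂ) (C : ℝ), IsCompact K → (∀ τ ∈ K, Φ (t, τ) ∈ D ∩ U) →
      (∀ τ ∈ frontier K, u (Φ (t, τ)) ≤ C) → ∀ τ ∈ K, u (Φ (t, τ)) ≤ C)
    {c : ℂ} {r : ℝ} (hdisc : ∀ τ ∈ closedBall c r, Φ (0, τ) ∈ D)
    (hsphere : ∀ t ∈ Icc (0 : ℝ) 1, ∀ τ ∈ sphere c r, Φ (t, τ) ∈ D) :
    ∀ τ ∈ closedBall c r, Φ (1, τ) ∈ D := by
  by_contra! hcon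
  obtain ⟨τ₂, hτ₂, hτ₂D⟩ := hcon
  have hbad : IsCompact (Icc (0 : ℝ) 1 ×ˢ closedBall c r ∩ Φ ⁻¹' Dᶜ) :=
    (isCompact_Icc.prod (isCompact_closedBall c r)).inter_right (hD.isClosed_compl.preimage hΦ)
  -- `t₁` is the least parameter whose disc leaves `D`.
  obtain ⟨⟨t₁, τ₁⟩, ⟨⟨ht₁, hτ₁⟩, hτ₁D⟩, hmin⟩ := hbad.exists_isMinOn
    ⟨(1, τ₂), ⟨⟨⟨zero_le_one, le_rfl⟩, hτ₂⟩, hτ₂D⟩⟩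
    (f := Prod.fst) continuous_fst.continuousOn
  have hin : ∀ t ∈ Ico (0 : ℝ) t₁, ∀ τ ∈ closedBall c r, Φ (t, τ) ∈ D := by
    intro t ht τ hτ
    by_contra hout
    have : t₁ ≤ t := hmin (a := (t, τ)) ⟨⟨⟨ht.1, ht.2.le.trans ht₁.2⟩, hτ⟩, hout⟩
    exact absurd ht.2 this.not_gt
  have ht₁0 : 0 < t₁ := lt_of_le_of_ne ht₁.1 fun h => hτ₁D (h ▸ hdisc τ₁ hτ₁)
  have hlim : ∀ τ, Tendsto (fun t : ℝ => Φ (t, τ)) (𝓝[<] t₁) (𝓝 (Φ (t₁, τ))) := fun τ =>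
    ((hΦ.comp (Continuous.prodMk_left τ)).tendsto t₁).mono_left nhdsWithin_le_nhds
  have hev : ∀ᶠ t in 𝓝[<] t₁, t ∈ Ico 0 t₁ := by
    filter_upwards [Ioo_mem_nhdsLT ht₁0] with t ht using ⟨ht.1.le, ht.2⟩
  have hfr : ∀ τ ∈ closedBall c r, Φ (t₁, τ) ∉ D → Φ (t₁, τ) ∈ frontier D := by
    intro τ hτ hout
    rw [hD.frontier_eq]
    refine ⟨mem_closure_of_tendsto (hlim τ) ?_, hout⟩
    filter_upwards [hev] with t ht using hin t ht τ hτ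
  -- The compact set `K` is a neighbourhood, in the disc, of the contact set with `∂D`, so small
  -- that the disc with parameter `t₁` stays in `U` on `K`.
  have hΦ₁ : Continuous fun τ => Φ (t₁, τ) := hΦ.comp (Continuous.prodMk_right t₁)
  obtain ⟨K, hK, hTK, hKV⟩ := exists_compact_between
    ((isCompact_closedBall c r).inter_right (hD.isClosed_compl.preimage hΦ₁))
    (isOpen_ball.inter (hU.preimage hΦ₁) : IsOpen (ball c r ∩ (fun τ => Φ (t₁, τ)) ⁻¹' U)) (by
      intro τ hτ
      refine ⟨?_, hDU (hfr τ hτ.1 hτ.2)⟩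
      by_contra hni
      exact hτ.2 (hsphere t₁ ht₁ τ (le_antisymm hτ.1 (not_lt.1 hni))))
  have hKball : K ⊆ closedBall c r := fun τ hτ => ball_subset_closedBall (hKV hτ).1
  have hFK : frontier K ⊆ K := hK.isClosed.frontier_subset
  have hFc : IsCompact (frontier K) := hK.of_isClosed_subset isClosed_frontier hFK
  have hFD : MapsTo (fun τ => Φ (t₁, τ)) (frontier K) (D ∩ U) := by
    intro τ hτ
    refine ⟨?_, (hKV (hFK hτ)).2⟩
    by_contra hout
    have h1 := hTK ⟨hKball (hFK hτ), hout⟩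
    rw [hK.isClosed.frontier_eq] at hτ
    exact hτ.2 h1
  obtain ⟨B, hB⟩ := (hFc.image_of_continuousOn (huc.comp hΦ₁.continuousOn hFD)).bddAbove
  -- Near `t₁`, the function `u` is bounded by `B + 1` on the boundary of the piece `K`.
  have hbdd : ∀ᶠ t in 𝓝 t₁, ∀ τ ∈ frontier K, u (Φ (t, τ)) ≤ B + 1 := by
    have hWo : IsOpen (Φ ⁻¹' ((D ∩ U) ∩ u ⁻¹' Iio (B + 1))) :=
      (huc.isOpen_inter_preimage (hD.inter hU) isOpen_Iio).preimage hΦ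
    refine hFc.eventually_forall_of_forall_eventually fun τ hτ => ?_
    filter_upwards [hWo.mem_nhds (x := (t₁, τ)) ⟨hFD hτ,
      (show u (Φ (t₁, τ)) ≤ B from hB ⟨τ, hτ, rfl⟩).trans_lt (lt_add_one B)⟩] with x hx
    exact le_of_lt hx.2
  have hKU : ∀ᶠ t in 𝓝 t₁, ∀ τ ∈ K, Φ (t, τ) ∈ U :=
    hK.eventually_forall_of_forall_eventually fun τ hτ =>
      (hU.preimage hΦ).mem_nhds (x := (t₁, τ)) (hKV hτ).2
  have hlimD : Tendsto (fun t : ℝ => Φ (t, τ₁)) (𝓝[<] t₁) (𝓝[D] (Φ (t₁, τ₁))) := by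
    refine tendsto_nhdsWithin_iff.2 ⟨hlim τ₁, ?_⟩
    filter_upwards [hev] with t ht using hin t ht τ₁ hτ₁
  have hblow : ∀ᶠ t in 𝓝[<] t₁, B + 1 < u (Φ (t, τ₁)) :=
    ((hub _ (hfr τ₁ hτ₁ hτ₁D)).comp hlimD).eventually_gt_atTop (B + 1)
  obtain ⟨t, h1, h2, h3, h4⟩ :=
    (hblow.and (hev.and ((hbdd.and hKU).filter_mono nhdsWithin_le_nhds))).exists
  have hle := hmax t K (B + 1) hK (fun τ hτ => ⟨hin t h2 τ (hKball hτ), h4 τ hτ⟩) h3 τ₁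
    (interior_subset (hTK ⟨hτ₁, hτ₁D⟩))
  exact absurd h1 hle.not_gt

/-- If `e^{-Re P}` is at most the boundary distance on the circle `|τ - c| = r` of a complex line,
then the discs `τ ↦ z + τ w + t e^{-P(τ)} e` with `|e| < 1` and `0 ≤ t ≤ 1` have their boundary in
`D`; hence the discs themselves lie in `D`. The conclusion is this for the centre and `t = 1`. -/
theorem add_exp_smul_mem_of_barrier {D U : Set (EuclideanSpace ℂ (Fin n))}
    (hD : IsOpen D) (hU : IsOpen U) (hDU : frontier D ⊆ U) {u : EuclideanSpace ℂ (Fin n) → ℝ}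
    (hu : PlurisubharmonicOn u (D ∩ U)) (huc : ContinuousOn u (D ∩ U))
    (hub : ∀ b ∈ frontier D, Tendsto u (𝓝[D] b) atTop)
    {z w e : EuclideanSpace ℂ (Fin n)} {c : ℂ} {r : ℝ} (hr : 0 < r)
    (hball : ∀ τ ∈ closedBall c r, z + τ • w ∈ D) {P : ℂ → ℂ} (hP : Differentiable ℂ P)
    (hle : ∀ τ ∈ sphere c r, Real.exp (-(P τ).re) ≤ infDist (z + τ • w) (frontier D))
    (he : ‖e‖ < 1) : z + c • w + Complex.exp (-P c) • e ∈ D := by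
  have hg : Differentiable ℂ fun τ => Complex.exp (-P τ) := by fun_prop
  set g : ℂ → ℂ := fun τ => Complex.exp (-P τ) with hgdef
  have hg0 : ∀ τ, g τ ≠ 0 := fun _ => Complex.exp_ne_zero _
  have hgn : ∀ τ, ‖g τ‖ = Real.exp (-(P τ).re) := fun τ => by
    rw [hgdef, Complex.norm_exp, Complex.neg_re]
  let Φ : ℝ × ℂ → EuclideanSpace ℂ (Fin n) := fun x => discFamily z w e g (x.2, x.1)
  have hΦ : Continuous Φ := (continuous_discFamily z w e hg.continuous).comp (by fun_prop)
  have hΦeq : ∀ (t : ℝ) (τ : ℂ), Φ (t, τ) = z + τ • w + (t * g τ) • e := fun _ _ => rfl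
  have hmax : ∀ (t : ℝ) (K : Set ℂ) (C : ℝ), IsCompact K → (∀ τ ∈ K, Φ (t, τ) ∈ D ∩ U) →
      (∀ τ ∈ frontier K, u (Φ (t, τ)) ≤ C) → ∀ τ ∈ K, u (Φ (t, τ)) ≤ C :=
    fun t K C hK hKD hC τ hτ =>
      le_on_disc_of_le_on_frontier (z := z) (w := w) (e := e) (μ₀ := (t : ℂ)) (hD.inter hU) hu huc
        hg hg0 hK hKD hC hτ
  have hdisc : ∀ τ ∈ closedBall c r, Φ (0, τ) ∈ D := fun τ hτ => by
    rw [hΦeq, ofReal_zero, zero_mul, zero_smul, add_zero]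
    exact hball τ hτ
  have hsphere : ∀ t ∈ Icc (0 : ℝ) 1, ∀ τ ∈ sphere c r, Φ (t, τ) ∈ D := fun t ht τ hτ => by
    refine mem_of_dist_lt_infDist_frontier hD (hball τ (sphere_subset_closedBall hτ)) ?_
    rw [hΦeq, dist_eq_norm, add_sub_cancel_left, norm_smul, norm_mul, Complex.norm_real,
      Real.norm_of_nonneg ht.1, hgn]
    refine lt_of_lt_of_le ?_ (hle τ hτ)
    calc t * Real.exp (-(P τ).re) * ‖e‖ ≤ 1 * Real.exp (-(P τ).re) * ‖e‖ := by
          gcongr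
          exact ht.2
      _ < 1 * Real.exp (-(P τ).re) * 1 := by gcongr
      _ = _ := by ring
  have h := disc_mem_of_barrier hD hU hDU huc hub hΦ hmax hdisc hsphere c
    (mem_closedBall_self hr.le)
  rwa [hΦeq, ofReal_one, one_mul] at h

/-- A continuous plurisubharmonic function near `∂D` that blows up at `∂D` makes
`-log dist(·, ∂D)` plurisubharmonic on all of `D`. If `-log dist ≤ Re P` on a circle, but not at the
centre, then a disc as in `add_exp_smul_mem_of_barrier` could be aimed at the boundary point
closest to the centre. -/
theorem plurisubharmonicOn_negLogDist_of_barrier {D U : Set (EuclideanSpace ℂ (Fin n))}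
    (hD : IsOpen D) (hne : (frontier D).Nonempty)
    (hU : IsOpen U) (hDU : frontier D ⊆ U) {u : EuclideanSpace ℂ (Fin n) → ℝ}
    (hu : PlurisubharmonicOn u (D ∩ U)) (huc : ContinuousOn u (D ∩ U))
    (hub : ∀ b ∈ frontier D, Tendsto u (𝓝[D] b) atTop) :
    PlurisubharmonicOn (negLogDist D) D := by
  refine plurisubharmonicOn_of_continuousOn (continuousOn_negLogDist hD hne) ?_
  intro z w c r hr hball hline
  refine le_circleAverage_of_entire_majorants hr hline ?_
  intro P hP hle
  by_contra! hlt
  have hc : z + c • w ∈ D := hball c (mem_closedBall_self hr.le)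
  have hpos := infDist_frontier_pos hD hne hc
  rw [negLogDist_eq hc, lt_neg, Real.log_lt_iff_lt_exp hpos] at hlt
  obtain ⟨b, hb, hbd⟩ := isClosed_frontier.exists_infDist_eq_dist hne (z + c • w)
  have hle' : ∀ τ ∈ sphere c r,
      Real.exp (-(P τ).re) ≤ infDist (z + τ • w) (frontier D) := fun τ hτ => by
    have hτD := hball τ (sphere_subset_closedBall hτ)
    have h1 := hle τ hτ
    rwa [negLogDist_eq hτD, neg_le,
      Real.le_log_iff_exp_le (infDist_frontier_pos hD hne hτD)] at h1
  have hen : ‖Complex.exp (P c) • (b - (z + c • w))‖ < 1 := by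
    rw [norm_smul, Complex.norm_exp, ← dist_eq_norm, dist_comm, ← hbd]
    calc Real.exp (P c).re * infDist (z + c • w) (frontier D)
        < Real.exp (P c).re * Real.exp (-(P c).re) := by gcongr
      _ = 1 := by rw [← Real.exp_add, add_neg_cancel, Real.exp_zero]
  have hmem := add_exp_smul_mem_of_barrier hD hU hDU hu huc hub hr hball hP hle' hen
  rw [smul_smul, ← Complex.exp_add, neg_add_cancel, Complex.exp_zero, one_smul,
    add_sub_cancel] at hmem
  rw [hD.frontier_eq] at hb
  exact hb.2 hmem

/-! ### Exhaustion functions -/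

/-- A continuous exhaustion function blows up at the boundary, since its sublevel sets are closed
and do not meet the boundary. -/
theorem tendsto_atTop_of_isCompact_sublevel {D : Set (EuclideanSpace ℂ (Fin n))} (hD : IsOpen D)
    {φ : EuclideanSpace ℂ (Fin n) → ℝ} (hφ : ∀ c : ℝ, IsCompact {z | z ∈ D ∧ φ z ≤ c})
    {b : EuclideanSpace ℂ (Fin n)} (hb : b ∈ frontier D) : Tendsto φ (𝓝[D] b) atTop := by
  refine tendsto_atTop.2 fun c => ?_
  have hbD : b ∉ {z | z ∈ D ∧ φ z ≤ c} := fun h => by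
    rw [hD.frontier_eq] at hb
    exact hb.2 h.1
  filter_upwards [self_mem_nhdsWithin,
    mem_nhdsWithin_of_mem_nhds ((hφ c).isClosed.isOpen_compl.mem_nhds hbD)] with z h1 h2
  by_contra! hlt
  exact h2 ⟨h1, hlt.le⟩

theorem isCompact_sublevel_negLogDist_add_norm {D : Set (EuclideanSpace ℂ (Fin n))}
    (hD : IsOpen D) (hne : (frontier D).Nonempty) (c : ℝ) :
    IsCompact {z | z ∈ D ∧ negLogDist D z + ‖z‖ ≤ c} := by
  have hset : {z | z ∈ D ∧ negLogDist D z + ‖z‖ ≤ c} =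
      closure D ∩ {z | Real.exp (‖z‖ - c) ≤ infDist z (frontier D)} := by
    ext z
    constructor
    · rintro ⟨hz, hle⟩
      refine ⟨subset_closure hz, ?_⟩
      rw [negLogDist_eq hz] at hle
      exact (Real.le_log_iff_exp_le (infDist_frontier_pos hD hne hz)).1 (by linarith)
    · rintro ⟨hz, hle⟩
      have hpos : 0 < infDist z (frontier D) := (Real.exp_pos _).trans_le hle
      have hzD : z ∈ D := by
        by_contra hout
        have : z ∈ frontier D := by rw [hD.frontier_eq]; exact ⟨hz, hout⟩
        rw [infDist_zero_of_mem this] at hpos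
        exact lt_irrefl _ hpos
      refine ⟨hzD, ?_⟩
      have := (Real.le_log_iff_exp_le hpos).2 hle
      rw [negLogDist_eq hzD]
      linarith
  obtain ⟨b, hb⟩ := hne
  refine Metric.isCompact_of_isClosed_isBounded ?_ ?_
  · rw [hset]
    exact isClosed_closure.inter
      (isClosed_le (by fun_prop) (continuous_infDist_pt _))
  · -- `‖z‖ - c ≤ log dist(z, ∂D) ≤ log (‖z‖ + ‖b‖)` bounds `‖z‖`, as `2 log x ≤ x + 2 log 2 - 2`.
    refine isBounded_iff_forall_norm_le.2 ⟨2 * c + ‖b‖ + 2 * Real.log 2, fun z hz => ?_⟩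
    obtain ⟨hzD, hle⟩ := hz
    have hpos := infDist_frontier_pos hD ⟨b, hb⟩ hzD
    rw [negLogDist_eq hzD] at hle
    have h1 : infDist z (frontier D) ≤ ‖z‖ + ‖b‖ := by
      refine (infDist_le_dist_of_mem hb).trans ?_
      rw [dist_eq_norm]
      exact norm_sub_le z b
    have h2 := Real.log_le_sub_one_of_pos (half_pos hpos)
    rw [Real.log_div hpos.ne' two_ne_zero] at h2
    linarith

theorem isPseudoconvex_of_plurisubharmonicOn_negLogDist {D : Set (EuclideanSpace ℂ (Fin n))}
    (hD : IsOpen D) (hne : (frontier D).Nonempty) (h : PlurisubharmonicOn (negLogDist D) D) :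
    IsPseudoconvex D :=
  ⟨hD, fun z => negLogDist D z + ‖z‖,
    (continuousOn_negLogDist hD hne).add continuous_norm.continuousOn,
    h.add (plurisubharmonicOn_norm D), isCompact_sublevel_negLogDist_add_norm hD hne⟩

end RigidPsc

theorem mainTheorem4 (n : ℕ) (f : ℝ → ℝ) (hf_mono : Monotone f)
    (hf_convex : ConvexOn ℝ Set.univ f) (hf_nonconst : ∃ x y : ℝ, f x ≠ f y)
    (D U : Set (EuclideanSpace ℂ (Fin n)))
    (hD_open : IsOpen D) (hD_conn : IsConnected D) (hD_proper : D ≠ Set.univ)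
    (hU_open : IsOpen U) (hU_nhd : frontier D ⊆ U) :
    RigidPsc.IsPseudoconvex D ↔
      RigidPsc.PlurisubharmonicOn (fun z => f (RigidPsc.negLogDist D z)) (D ∩ U) := by
  have hne : (frontier D).Nonempty := nonempty_frontier_iff.2 ⟨hD_conn.nonempty, hD_proper⟩
  have hqc := RigidPsc.continuousOn_negLogDist hD_open hne
  constructor
  · rintro ⟨-, φ, hφc, hφ, hφK⟩
    have hq : RigidPsc.PlurisubharmonicOn (RigidPsc.negLogDist D) D :=
      RigidPsc.plurisubharmonicOn_negLogDist_of_barrier hD_open hne isOpen_univ (subset_univ _)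
        (hφ.mono inter_subset_left) (hφc.mono inter_subset_left)
        fun b hb => RigidPsc.tendsto_atTop_of_isCompact_sublevel hD_open hφK hb
    exact (hq.convex_comp hqc hf_mono hf_convex).mono inter_subset_left
  · intro h
    have hcont : Continuous f := continuousOn_univ.1 (hf_convex.continuousOn isOpen_univ)
    refine RigidPsc.isPseudoconvex_of_plurisubharmonicOn_negLogDist hD_open hne ?_
    exact RigidPsc.plurisubharmonicOn_negLogDist_of_barrier hD_open hne hU_open hU_nhd h
      ((hcont.comp_continuousOn hqc).mono inter_subset_left) fun b hb =>
        (hf_mono.tendsto_atTop_of_convexOn hf_convex hf_nonconst).comp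
          (RigidPsc.tendsto_negLogDist_atTop hD_open hb)
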